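/- Let $R$ be a commutative noetherian ring, let $I,J$ be ideals of $R$, and let $M$ be an $R$-module. "Finite" means finitely generated. Put $W(I,J)=\{\mathfrak p\in\operatorname{Spec}R : I^k\subseteq\mathfrak p+J \text{ for some } k\ge 1\}$ and let $\tilde W(I,J)$ be the set of all ideals $\mathfrak a$ of $R$ with $I^k\subseteq\mathfrak a+J$ for some $k\ge 0$. Let $\Gamma_{I,J}(M)$ be the submodule $\{x\in M : \operatorname{Supp}(Rx)\subseteq W(I,J)\}$ of $M$, let $H^i_{I,J}$ be the $i$-th right derived functor of $\Gamma_{I,J}$, and let $\operatorname{cd}(I,J,M)=\sup\{i\ge 0 : H^i_{I,J}(M)\neq 0\}$. The Krull dimension $\dim M$ is the supremum of the lengths of chains of primes in $\operatorname{Supp}M$. The module $M$ is called a ZD-module if for every submodule $N$ of $M$ the set of zero divisors of $M/N$ (the $r\in R$ with $rx=0$ for some $0\ne x\in M/N$) is a union of finitely many prime ideals in $\operatorname{Ass}_R(M/N)$. **Corollary 4.6.** Let $M$ be a ZD-module of finite Krull dimension and let $n\geq 1$ be an integer. (i) If $H^i_{I,J}(M)$ is finite for all $i>n$, then the following are equivalent: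 $H^n_{I,J}(M)$ is finite; there exist $\mathfrak a\in\tilde W(I,J)$ and $m\ge 0$ such that $\mathfrak a^mH^n_{I,J}(M)$ is finite; there exist $\mathfrak a\in\tilde W(I,J)$ and $m\ge 0$ such that $H^n_{I,J}(M)/(0:_{H^n_{I,J}(M)}\mathfrak a^m)$ is finite. (ii) If $H^i_{I,J}(M)$ is artinian for all $i>n$, then $H^n_{I,J}(M)$ is artinian if and only if there exist $\mathfrak a\in\tilde W(I,J)$ and $m\ge 0$ such that $\mathfrak a^mH^n_{I,J}(M)$ is artinian. (iii) If $H^i_{I,J}(M)=0$ for all $i>n$, then $H^n_{I,J}(M)=\mathfrak a^jH^n_{I,J}(M)$ for all $\mathfrak a\in\tilde W(I,J)$ and all $j\ge 0$; moreover, $H^n_{I,J}(M)=0$ if and only if there exist $\mathfrak a\in\tilde W(I,J)$ and $m\ge 0$ such that $\mathfrak a^mH^n_{I,J}(M)=0$. In particular, if $n=\dim M$ or $n=\operatorname{cd}(I,J,M)$ (and $n\ge 1$), then $H^i_{I,J}(M)=0$ for all $i>n$, and all the conclusions of (i), (ii) and (iii) hold for this $n$. -/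

import Mathlib

universe u

namespace PairLocalCohomology

open CategoryTheory

section Pair

variable {R : Type u} [CommRing R]

/-- `W(I,J)`: the primes `p` with `I ^ n ⊆ p + J` for some `n ≥ 1`. -/
def W (I J : Ideal R) : Set (PrimeSpectrum R) :=
  {p | ∃ n : ℕ, 1 ≤ n ∧ I ^ n ≤ p.asIdeal + J}

/-- `W̃(I,J)`: the ideals `𝔞` with `I ^ n ⊆ 𝔞 + J` for some `n ≥ 0`. -/
def WTilde (I J : Ideal R) : Set (Ideal R) :=
  {𝔞 | ∃ n : ℕ, I ^ n ≤ 𝔞 + J}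

variable {M N : Type u} [AddCommGroup M] [Module R M] [AddCommGroup N] [Module R N]

theorem mem_support_span_singleton_iff (x : M) (p : PrimeSpectrum R) :
    p ∈ Module.support R (Submodule.span R {x}) ↔
      ∀ r : R, r • x = 0 → r ∈ p.asIdeal := by
  rw [Module.support_eq_zeroLocus, PrimeSpectrum.mem_zeroLocus]
  constructor
  · intro h r hr
    exact h (by simpa [Submodule.mem_annihilator_span_singleton] using hr)
  · intro h r hr
    exact h r (by simpa [Submodule.mem_annihilator_span_singleton] using hr)

/-- The `(I,J)`-torsion submodule `Γ_{I,J}(M) = {x ∈ M | Supp (R x) ⊆ W(I,J)}`. -/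
def gamma (I J : Ideal R) (M : Type u) [AddCommGroup M] [Module R M] : Submodule R M where
  carrier := {x | Module.support R (Submodule.span R {x}) ⊆ W I J}
  zero_mem' := by
    intro p hp
    rw [mem_support_span_singleton_iff] at hp
    exact absurd ((Ideal.eq_top_iff_one _).mpr (hp 1 (by simp))) p.isPrime.ne_top
  add_mem' := by
    intro x y hx hy p hp
    by_contra hW
    have h1 : p ∉ Module.support R (Submodule.span R {x}) := fun h => hW (hx h)
    have h2 : p ∉ Module.support R (Submodule.span R {y}) := fun h => hW (hy h)
    rw [mem_support_span_singleton_iff] at h1 h2 hp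
    push Not at h1 h2
    obtain ⟨a, ha, hap⟩ := h1
    obtain ⟨b, hb, hbp⟩ := h2
    have hab : (a * b) • (x + y) = 0 := by
      rw [smul_add, mul_comm a b, mul_smul, ha, mul_comm b a, mul_smul, hb]
      simp
    rcases p.isPrime.mem_or_mem (hp _ hab) with h | h
    · exact hap h
    · exact hbp h
  smul_mem' := by
    intro c x hx p hp
    apply hx
    rw [mem_support_span_singleton_iff] at hp ⊢
    intro r hr
    exact hp r (by rw [smul_comm, hr, smul_zero])

theorem map_mem_gamma (I J : Ideal R) (f : M →ₗ[R] N) (x : M) (hx : x ∈ gamma I J M) :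
    f x ∈ gamma I J N := by
  intro p hp
  apply hx
  rw [mem_support_span_singleton_iff] at hp ⊢
  intro r hr
  exact hp r (by rw [← map_smul, hr, map_zero])

/-- The `(I,J)`-torsion functor `Γ_{I,J}`: it sends `M` to `Γ_{I,J}(M)` and a linear map to its
restriction. -/
def gammaFunctor (I J : Ideal R) : ModuleCat.{u} R ⥤ ModuleCat.{u} R where
  obj M := ModuleCat.of R (gamma I J M)
  map f := ModuleCat.ofHom (f.hom.restrict fun x hx => map_mem_gamma I J f.hom x hx)

instance (I J : Ideal R) : (gammaFunctor I J).Additive where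

/-- `H^i_{I,J}(M)`: the `i`-th right derived functor of `Γ_{I,J}`, evaluated at `M`. -/
noncomputable def H (I J : Ideal R) (i : ℕ) (M : Type u) [AddCommGroup M] [Module R M] :
    ModuleCat.{u} R :=
  ((gammaFunctor I J).rightDerived i).obj (ModuleCat.of R M)

/-- `cd(I,J,M) = sup {i ≥ 0 | H^i_{I,J}(M) ≠ 0}` (it is `⊥` if there is no such `i`). -/
noncomputable def cd (I J : Ideal R) (M : Type u) [AddCommGroup M] [Module R M] :
    WithBot ℕ∞ :=
  ⨆ (i : ℕ) (_ : Nontrivial (H I J i M)), (i : WithBot ℕ∞)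

end Pair

/-- `M` is a ZD-module (zero-divisor module): for every submodule `N`, the set of zero divisors
of `M / N` is the union of finitely many members of `Ass (M / N)`. -/
def IsZDModule (R M : Type u) [CommRing R] [AddCommGroup M] [Module R M] : Prop :=
  ∀ N : Submodule R M, ∃ s : Set (Ideal R), s.Finite ∧ s ⊆ associatedPrimes R (M ⧸ N) ∧
    {r : R | ∃ x : M ⧸ N, x ≠ 0 ∧ r • x = 0} = ⋃ p ∈ s, (p : Set R)

end PairLocalCohomology

/-!
The engine is a statement about Serre classes. Let `M` be a ZD-module of finite dimension and let
`n ≥ 1`. If `Hⁱ(M)` lies in a Serre class for all `i > n`, then so does `Hⁿ(M) / 𝔞 Hⁿ(M)` for every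
`𝔞 ∈ W̃(I,J)` (`IsSerreProperty.H_quotient_smul_top`). Applied to the powers of `𝔞` and to the
classes of finite, artinian and zero modules it gives the three parts of the theorem, since
`Hⁿ(M)` is an extension of `Hⁿ(M) / 𝔞ᵐ Hⁿ(M)` by `𝔞ᵐ Hⁿ(M)`, and `𝔞ᵐ Hⁿ(M)` is a quotient of a
finite power of `Hⁿ(M) / (0 : 𝔞ᵐ)`.

The statement is proved by induction on `dim M`. Positive local cohomology does not change when `M`
is replaced by `M / Γ_{I,J}(M)`, because torsion modules are acyclic
(`subsingleton_H_succ_of_gamma_eq_top`), which rests on the injectivity of `Γ_{I,J}(E)` for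
injective `E` over a noetherian ring (`injective_gamma`, by Artin–Rees). Once `M` has no torsion,
prime avoidance, available because `M` is a ZD-module, yields an `M`-regular `x ∈ 𝔞`
(`exists_isSMulRegular`). The dimension drops for `M / x M`, and the long exact sequence of
`0 → M → M → M / x M → 0` embeds `Hⁿ(M) / x Hⁿ(M)` into `Hⁿ(M / x M)` with cokernel inside
`Hⁿ⁺¹(M)`. The same induction gives `Hⁱ(M) = 0` for `i > dim M`
(`subsingleton_H_of_supportDim_lt`), because every element of `Hⁱ(M)` is torsion.

The long exact sequence of right derived functors is obtained from the horseshoe lemma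
(`exists_horseshoe`): the middle resolution is the direct sum of the outer two with a twisted
differential.
-/

namespace PairLocalCohomology

open CategoryTheory Limits

/-! ### The long exact sequence of right derived functors -/

section LongExactSequence

universe v₁ u₁ v₂ u₂

variable {C : Type u₁} [Category.{v₁} C] [Abelian C]

/-- The augmentation `X ⟶ I⁰` of an injective resolution, as a morphism of `C`. -/
noncomputable def augmentation {X : C} (I : InjectiveResolution X) : X ⟶ I.cocomplex.X 0 :=
  I.ι.f 0

instance {X : C} (I : InjectiveResolution X) : Mono (augmentation I) :=
  inferInstanceAs (Mono (I.ι.f 0))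

theorem augmentation_d {X : C} (I : InjectiveResolution X) :
    augmentation I ≫ I.cocomplex.d 0 1 = 0 :=
  I.ι_f_zero_comp_complex_d

theorem augmentation_exact {X : C} (I : InjectiveResolution X) :
    (ShortComplex.mk _ _ (augmentation_d I)).Exact :=
  I.exact₀

/-- An injective resolution assembled from an exact sequence `0 ⟶ B ⟶ K⁰ ⟶ K¹ ⟶ ⋯` of which all
the `Kⁿ` are injective. -/
noncomputable abbrev injectiveResolutionOfExact {B : C} (K : CochainComplex C ℕ)
    (hK : ∀ n, Injective (K.X n)) (e : B ⟶ K.X 0) (he : e ≫ K.d 0 1 = 0) (hmono : Mono e)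
    (hexact : (ShortComplex.mk e (K.d 0 1) he).Exact) (hsucc : ∀ n, K.ExactAt (n + 1)) :
    InjectiveResolution B where
  cocomplex := K
  injective := hK
  ι := (CochainComplex.fromSingle₀Equiv _ _).symm ⟨e, he⟩
  quasiIso := ⟨fun n => by
    cases n
    · rw [CochainComplex.quasiIsoAt₀_iff, ShortComplex.quasiIso_iff_of_zeros]
      · refine (ShortComplex.exact_and_mono_f_iff_of_iso ?_).2 ⟨hexact, hmono⟩
        exact ShortComplex.isoMk (Iso.refl _) (Iso.refl _) (Iso.refl _)
          (by simp; exact (Category.id_comp e).trans (Category.comp_id e).symm)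
          ((Category.id_comp (K.d 0 1)).trans (Category.comp_id _).symm)
      · rfl
      · rfl
      · exact K.shape _ _ (by simp)
    · rw [quasiIsoAt_iff_exactAt]
      · apply hsucc
      · apply CochainComplex.exactAt_succ_single_obj⟩

theorem augmentation_injectiveResolutionOfExact {B : C} (K : CochainComplex C ℕ)
    (hK : ∀ n, Injective (K.X n)) (e : B ⟶ K.X 0) (he : e ≫ K.d 0 1 = 0) (hmono : Mono e)
    (hexact : (ShortComplex.mk e (K.d 0 1) he).Exact) (hsucc : ∀ n, K.ExactAt (n + 1)) :
    augmentation (injectiveResolutionOfExact K hK e he hmono hexact hsucc) = e := by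
  simp [augmentation, injectiveResolutionOfExact]

/-- The complex `I¹ ⟶ I² ⟶ ⋯` with the differentials negated. -/
noncomputable abbrev shiftedComplex (I : CochainComplex C ℕ) : CochainComplex C ℕ where
  X n := I.X (n + 1)
  d i j := -I.d (i + 1) (j + 1)
  shape i j h := by
    rw [I.shape, neg_zero]
    simpa using h
  d_comp_d' := by simp

/-- A cochain complex that is degreewise the biproduct of `I` and `K`, with the differential of the
direct sum twisted by the maps `t n : Kⁿ ⟶ Iⁿ⁺¹`. -/
structure TwistedSum (I K : CochainComplex C ℕ) (t : ∀ n, K.X n ⟶ I.X (n + 1)) where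
  /-- the total complex -/
  cocomplex : CochainComplex C ℕ
  /-- the inclusion of the subcomplex -/
  inl : I ⟶ cocomplex
  /-- the projection to the quotient complex -/
  snd : cocomplex ⟶ K
  /-- the degreewise retraction of the inclusion -/
  fst : ∀ n, cocomplex.X n ⟶ I.X n
  /-- the degreewise section of the projection -/
  inr : ∀ n, K.X n ⟶ cocomplex.X n
  inl_snd : inl ≫ snd = 0
  inl_fst : ∀ n, inl.f n ≫ fst n = 𝟙 _
  inr_snd : ∀ n, inr n ≫ snd.f n = 𝟙 _
  total : ∀ n, fst n ≫ inl.f n + snd.f n ≫ inr n = 𝟙 _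
  d_fst : ∀ n, cocomplex.d n (n + 1) ≫ fst (n + 1) = fst n ≫ I.d n (n + 1) + snd.f n ≫ t n

theorem exists_twistedSum (I K : CochainComplex C ℕ) (t : ∀ n, K.X n ⟶ I.X (n + 1))
    (ht : ∀ n, t n ≫ I.d (n + 1) (n + 2) + K.d n (n + 1) ≫ t (n + 1) = 0) :
    Nonempty (TwistedSum I K t) := by
  let d (n : ℕ) : I.X n ⊞ K.X n ⟶ I.X (n + 1) ⊞ K.X (n + 1) :=
    biprod.desc (I.d n (n + 1) ≫ biprod.inl) (t n ≫ biprod.inl + K.d n (n + 1) ≫ biprod.inr)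
  have hd (n : ℕ) : d n ≫ d (n + 1) = 0 := by
    ext
    · simp [d]
    · simp [d]
    · simpa [d] using ht n
    · simp [d]
  have hod (n : ℕ) : (CochainComplex.of _ d hd).d n (n + 1) = d n :=
    CochainComplex.of_d (fun n => I.X n ⊞ K.X n) d n
  exact ⟨{
    cocomplex := CochainComplex.of (fun n => I.X n ⊞ K.X n) d hd
    inl :=
      { f := fun n => biprod.inl
        comm' := by
          rintro i _ rfl
          rw [hod]
          simp [d] }
    snd :=
      { f := fun n => biprod.snd
        comm' := by
          rintro i _ rfl
          rw [hod]
          ext <;> simp [d] }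
    fst := fun n => biprod.fst
    inr := fun n => biprod.inr
    inl_snd := by
      ext n
      simp
    inl_fst := fun n => by simp
    inr_snd := fun n => by simp
    total := fun n => biprod.total
    d_fst := fun n => by
      rw [hod]
      ext <;> simp [d] }⟩

namespace TwistedSum

variable {I K : CochainComplex C ℕ} {t : ∀ n, K.X n ⟶ I.X (n + 1)} (T : TwistedSum I K t)

theorem inl_f_snd_f (n : ℕ) : T.inl.f n ≫ T.snd.f n = 0 := by
  rw [← HomologicalComplex.comp_f, T.inl_snd, HomologicalComplex.zero_f]

theorem inr_fst (n : ℕ) : T.inr n ≫ T.fst n = 0 := by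
  have h := T.inr n ≫= T.total n
  rw [Preadditive.comp_add, ← Category.assoc (T.inr n) (T.snd.f n), T.inr_snd, Category.id_comp,
    Category.comp_id, add_eq_right] at h
  have h' := h =≫ T.fst n
  rwa [Category.assoc, Category.assoc, T.inl_fst, Category.comp_id, zero_comp] at h'

theorem hom_ext {Z : C} {n : ℕ} {a b : Z ⟶ T.cocomplex.X n} (h₁ : a ≫ T.fst n = b ≫ T.fst n)
    (h₂ : a ≫ T.snd.f n = b ≫ T.snd.f n) : a = b := by
  rw [← Category.comp_id a, ← Category.comp_id b, ← T.total n, Preadditive.comp_add,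
    Preadditive.comp_add, ← Category.assoc, ← Category.assoc a, h₁, h₂, Category.assoc,
    Category.assoc]

/-- The short complex `I ⟶ T ⟶ K`. -/
noncomputable abbrev shortComplex : ShortComplex (CochainComplex C ℕ) :=
  ShortComplex.mk T.inl T.snd T.inl_snd

/-- The short complex `I ⟶ T ⟶ K` splits in every degree. -/
noncomputable def splitting (n : ℕ) :
    (T.shortComplex.map (HomologicalComplex.eval C _ n)).Splitting where
  r := T.fst n
  s := T.inr n
  f_r := T.inl_fst n
  s_g := T.inr_snd n
  id := T.total n

theorem shortExact : T.shortComplex.ShortExact :=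
  HomologicalComplex.shortExact_of_degreewise_shortExact _ fun n => (T.splitting n).shortExact

theorem injective (n : ℕ) [Injective (I.X n)] [Injective (K.X n)] :
    Injective (T.cocomplex.X n) :=
  Injective.of_iso (P := I.X n ⊞ K.X n)
    { hom := biprod.desc (T.inl.f n) (T.inr n)
      inv := biprod.lift (T.fst n) (T.snd.f n)
      hom_inv_id := by ext <;> simp [T.inl_fst, T.inl_f_snd_f, T.inr_fst, T.inr_snd]
      inv_hom_id := by simp [T.total] } inferInstance

end TwistedSum

/-- A map from the bottom of a resolution `K` of `Z` into the cycles of `I¹` extends, up to sign,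
to a chain map into the shifted complex. -/
theorem exists_twist {X Z : C} (I : InjectiveResolution X) (K : InjectiveResolution Z)
    (γ : Z ⟶ I.cocomplex.X 1) (hγ : γ ≫ I.cocomplex.d 1 2 = 0) :
    ∃ t : ∀ n, K.cocomplex.X n ⟶ I.cocomplex.X (n + 1),
      (∀ n, t n ≫ I.cocomplex.d (n + 1) (n + 2) + K.cocomplex.d n (n + 1) ≫ t (n + 1) = 0) ∧
      augmentation K ≫ t 0 = -γ := by
  have inj : ∀ n, Injective ((shiftedComplex I.cocomplex).X n) := fun n => I.injective (n + 1)
  let t0 : K.cocomplex.X 0 ⟶ I.cocomplex.X 1 := Injective.factorThru (-γ) (augmentation K)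
  have ht0 : augmentation K ≫ t0 = -γ := Injective.comp_factorThru _ _
  have h0 : augmentation K ≫ t0 ≫ (-I.cocomplex.d 1 2) = 0 := by
    rw [← Category.assoc, ht0]
    simpa using hγ
  let t1 : K.cocomplex.X 1 ⟶ I.cocomplex.X 2 :=
    (augmentation_exact K).descToInjective (t0 ≫ (-I.cocomplex.d 1 2)) h0
  have ht1 : K.cocomplex.d 0 1 ≫ t1 = t0 ≫ (-I.cocomplex.d 1 2) :=
    (augmentation_exact K).comp_descToInjective _ h0
  let T : K.cocomplex ⟶ shiftedComplex I.cocomplex :=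
    CochainComplex.mkHom _ _ t0 t1 ht1.symm fun n p =>
      have h : K.cocomplex.d n (n + 1) ≫ p.2.1 ≫
          (shiftedComplex I.cocomplex).d (n + 1) (n + 2) = 0 := by
        rw [← Category.assoc, ← p.2.2, Category.assoc, HomologicalComplex.d_comp_d, comp_zero]
      ⟨(K.exact_succ n).descToInjective (p.2.1 ≫ (shiftedComplex I.cocomplex).d (n + 1) (n + 2)) h,
        ((K.exact_succ n).comp_descToInjective _ h).symm⟩
  refine ⟨fun n => T.f n, fun n => ?_, ht0⟩
  rw [← T.comm n (n + 1), Preadditive.comp_neg, add_neg_cancel]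

/-- The **horseshoe lemma**: injective resolutions of the outer terms of a short exact sequence
extend to a degreewise split short exact sequence of resolutions. -/
theorem exists_horseshoe {S : ShortComplex C} (hS : S.ShortExact) (I : InjectiveResolution S.X₁)
    (K : InjectiveResolution S.X₃) :
    ∃ (P : InjectiveResolution S.X₂) (i : I.cocomplex ⟶ P.cocomplex)
      (p : P.cocomplex ⟶ K.cocomplex) (w : i ≫ p = 0),
      (∀ n, Nonempty ((ShortComplex.mk i p w).map (HomologicalComplex.eval C _ n)).Splitting) ∧
      augmentation I ≫ i.f 0 = S.f ≫ augmentation P ∧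
      augmentation P ≫ p.f 0 = S.g ≫ augmentation K := by
  have := hS.mono_f
  have := hS.epi_g
  -- the twist is a lift of the obstruction `γ` to `β` being a cocycle
  let β : S.X₂ ⟶ I.cocomplex.X 0 := Injective.factorThru (augmentation I) S.f
  have hβ : S.f ≫ β = augmentation I := Injective.comp_factorThru _ _
  let γ : S.X₃ ⟶ I.cocomplex.X 1 := hS.exact.desc (β ≫ I.cocomplex.d 0 1) (by
    rw [← Category.assoc, hβ, augmentation_d])
  have hγ : S.g ≫ γ = β ≫ I.cocomplex.d 0 1 := hS.exact.g_desc _ _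
  obtain ⟨t, ht, ht0⟩ := exists_twist I K γ (by
    rw [← cancel_epi S.g, ← Category.assoc, hγ]
    simp)
  obtain ⟨T⟩ := exists_twistedSum I.cocomplex K.cocomplex t ht
  let e : S.X₂ ⟶ T.cocomplex.X 0 := β ≫ T.inl.f 0 + (S.g ≫ augmentation K) ≫ T.inr 0
  have hfst : e ≫ T.fst 0 = β := by
    simp [e, T.inl_fst, T.inr_fst]
  have hsnd : e ≫ T.snd.f 0 = S.g ≫ augmentation K := by
    simp [e, T.inl_f_snd_f, T.inr_snd]
  have he : e ≫ T.cocomplex.d 0 1 = 0 := by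
    apply T.hom_ext
    · rw [Category.assoc, T.d_fst, Preadditive.comp_add, ← Category.assoc, ← Category.assoc, hfst,
        hsnd, Category.assoc, ht0, Preadditive.comp_neg, hγ, add_neg_cancel, zero_comp]
    · rw [Category.assoc, ← T.snd.comm, ← Category.assoc, hsnd, Category.assoc, augmentation_d,
        comp_zero, zero_comp]
  have hsf : augmentation I ≫ T.inl.f 0 = S.f ≫ e := by
    apply T.hom_ext
    · rw [Category.assoc, T.inl_fst, Category.comp_id, Category.assoc, hfst, hβ]
    · rw [Category.assoc, T.inl_f_snd_f, Category.assoc, hsnd, ← Category.assoc, S.zero, zero_comp,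
        comp_zero]
  clear_value e
  have hmono : Mono e := by
    rw [Preadditive.mono_iff_cancel_zero]
    intro Z z hz
    have h1 : z ≫ S.g = 0 := by
      rw [← cancel_mono (augmentation K), Category.assoc, ← hsnd, ← Category.assoc, hz, zero_comp,
        zero_comp]
    obtain ⟨w, rfl⟩ : ∃ w, w ≫ S.f = z := ⟨hS.exact.lift z h1, hS.exact.lift_f _ _⟩
    have h2 : w ≫ augmentation I = 0 := by
      rw [← hβ, ← hfst, ← Category.assoc, ← Category.assoc, hz, zero_comp]
    rw [(cancel_mono (augmentation I)).1 (h2.trans zero_comp.symm), zero_comp]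
  have hexact : (ShortComplex.mk e (T.cocomplex.d 0 1) he).Exact := by
    rw [ShortComplex.exact_iff_exact_up_to_refinements]
    intro Z z hz
    dsimp at z hz ⊢
    have hz2 : (z ≫ T.snd.f 0) ≫ K.cocomplex.d 0 1 = 0 := by
      rw [Category.assoc, T.snd.comm, ← Category.assoc, hz, zero_comp]
    -- lift the `K`-component of `z` to `S.X₂`; the difference lands in `I⁰` and comes from `S.X₁`
    obtain ⟨y, hy⟩ : ∃ y : Z ⟶ S.X₃, y ≫ augmentation K = z ≫ T.snd.f 0 :=
      have : Mono (ShortComplex.mk _ _ (augmentation_d K)).f :=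
        inferInstanceAs (Mono (augmentation K))
      ⟨(augmentation_exact K).lift _ hz2, (augmentation_exact K).lift_f _ _⟩
    obtain ⟨A, π, hπ, b, hb⟩ := surjective_up_to_refinements_of_epi S.g y
    have hw2 : (π ≫ z - b ≫ e) ≫ T.snd.f 0 = 0 := by
      rw [Preadditive.sub_comp, Category.assoc, Category.assoc, ← hy, hsnd, ← Category.assoc, hb,
        Category.assoc, sub_self]
    have hw : (π ≫ z - b ≫ e) = ((π ≫ z - b ≫ e) ≫ T.fst 0) ≫ T.inl.f 0 := by
      apply T.hom_ext
      · rw [Category.assoc _ (T.inl.f 0), T.inl_fst, Category.comp_id]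
      · rw [hw2, Category.assoc, T.inl_f_snd_f, comp_zero]
    have hwd : ((π ≫ z - b ≫ e) ≫ T.fst 0) ≫ I.cocomplex.d 0 1 = 0 := by
      have h1 := (π ≫ z - b ≫ e) ≫= T.d_fst 0
      rw [Preadditive.comp_add, ← Category.assoc _ (T.snd.f 0), hw2, zero_comp, add_zero,
        ← Category.assoc, Preadditive.sub_comp, Category.assoc, hz, Category.assoc, he, comp_zero,
        comp_zero, sub_zero, zero_comp] at h1
      rw [Category.assoc, ← h1]
    obtain ⟨x, hx⟩ : ∃ x : A ⟶ S.X₁, x ≫ augmentation I = (π ≫ z - b ≫ e) ≫ T.fst 0 :=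
      have : Mono (ShortComplex.mk _ _ (augmentation_d I)).f :=
        inferInstanceAs (Mono (augmentation I))
      ⟨(augmentation_exact I).lift _ hwd, (augmentation_exact I).lift_f _ _⟩
    refine ⟨A, π, hπ, b + x ≫ S.f, ?_⟩
    rw [Preadditive.add_comp, Category.assoc, ← hsf, ← Category.assoc, hx, ← hw]
    abel
  have hsucc (n : ℕ) : T.cocomplex.ExactAt (n + 1) := by
    rw [HomologicalComplex.exactAt_iff_isZero_homology]
    refine (T.shortExact.homology_exact₂ (n + 1)).isZero_of_both_zeros ?_ ?_
    · exact ((HomologicalComplex.exactAt_iff_isZero_homology _ _).1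
        (I.cocomplex_exactAt_succ n)).eq_of_src _ _
    · exact ((HomologicalComplex.exactAt_iff_isZero_homology _ _).1
        (K.cocomplex_exactAt_succ n)).eq_of_tgt _ _
  refine ⟨injectiveResolutionOfExact T.cocomplex (fun n => T.injective n) e he hmono hexact hsucc,
    T.inl, T.snd, T.inl_snd, fun n => ⟨T.splitting n⟩, ?_, ?_⟩
  · rw [augmentation_injectiveResolutionOfExact]
    exact hsf
  · rw [augmentation_injectiveResolutionOfExact]
    exact hsnd

variable {D : Type u₂} [Category.{v₂} D] [Abelian D] [EnoughInjectives C]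

/-- The **long exact sequence** of the right derived functors of an additive functor. -/
theorem exists_rightDerived_exact (F : C ⥤ D) [F.Additive] {S : ShortComplex C}
    (hS : S.ShortExact) (n : ℕ) :
    ∃ (δ : (F.rightDerived n).obj S.X₃ ⟶ (F.rightDerived (n + 1)).obj S.X₁)
      (w₂ : (F.rightDerived n).map S.f ≫ (F.rightDerived n).map S.g = 0)
      (w₃ : (F.rightDerived n).map S.g ≫ δ = 0)
      (w₁ : δ ≫ (F.rightDerived (n + 1)).map S.f = 0),
      (ShortComplex.mk _ _ w₂).Exact ∧ (ShortComplex.mk _ _ w₃).Exact ∧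
        (ShortComplex.mk _ _ w₁).Exact := by
  let I := InjectiveResolution.of S.X₁
  let K := InjectiveResolution.of S.X₃
  obtain ⟨P, i, p, w, hsplit, hi, hp⟩ := exists_horseshoe hS I K
  let Φ := F.mapHomologicalComplex (ComplexShape.up ℕ)
  let T : ShortComplex (CochainComplex D ℕ) := (ShortComplex.mk i p w).map Φ
  have hT : T.ShortExact := HomologicalComplex.shortExact_of_degreewise_shortExact _ fun n =>
    ((hsplit n).some.map F).shortExact
  have hrel : (ComplexShape.up ℕ).Rel n (n + 1) := rfl
  let a (m : ℕ) : (F.rightDerived m).obj S.X₁ ≅ T.X₁.homology m := I.isoRightDerivedObj F m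
  let b (m : ℕ) : (F.rightDerived m).obj S.X₂ ≅ T.X₂.homology m := P.isoRightDerivedObj F m
  let c (m : ℕ) : (F.rightDerived m).obj S.X₃ ≅ T.X₃.homology m := K.isoRightDerivedObj F m
  have e₁ (m : ℕ) : (a m).hom ≫ HomologicalComplex.homologyMap T.f m =
      (F.rightDerived m).map S.f ≫ (b m).hom :=
    (InjectiveResolution.isoRightDerivedObj_hom_naturality S.f I P i hi F m).symm
  have e₂ : (b n).hom ≫ HomologicalComplex.homologyMap T.g n =
      (F.rightDerived n).map S.g ≫ (c n).hom :=
    (InjectiveResolution.isoRightDerivedObj_hom_naturality S.g P K p hp F n).symm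
  clear_value a b c T
  let δ := (c n).hom ≫ hT.δ n (n + 1) hrel ≫ (a (n + 1)).inv
  have e₃ : (c n).hom ≫ hT.δ n (n + 1) hrel = δ ≫ (a (n + 1)).hom := by
    rw [Category.assoc, Category.assoc, Iso.inv_hom_id, Category.comp_id]
  clear_value δ
  have w₂ : (F.rightDerived n).map S.f ≫ (F.rightDerived n).map S.g = 0 := by
    rw [← cancel_mono (c n).hom, Category.assoc, ← e₂, ← Category.assoc, ← e₁, Category.assoc,
      ← HomologicalComplex.homologyMap_comp, T.zero, HomologicalComplex.homologyMap_zero,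
      comp_zero, zero_comp]
  have w₃ : (F.rightDerived n).map S.g ≫ δ = 0 := by
    rw [← cancel_mono (a (n + 1)).hom, Category.assoc, ← e₃, ← Category.assoc, ← e₂,
      Category.assoc, hT.comp_δ, comp_zero, zero_comp]
  have w₁ : δ ≫ (F.rightDerived (n + 1)).map S.f = 0 := by
    rw [← cancel_mono (b (n + 1)).hom, Category.assoc, ← e₁, ← Category.assoc, ← e₃,
      Category.assoc, hT.δ_comp, comp_zero, zero_comp]
  refine ⟨δ, w₂, w₃, w₁, ?_, ?_, ?_⟩
  · exact ShortComplex.exact_of_iso (ShortComplex.isoMk (a n) (b n) (c n) (e₁ n) e₂).symm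
      (hT.homology_exact₂ n)
  · exact ShortComplex.exact_of_iso (ShortComplex.isoMk (b n) (c n) (a (n + 1)) e₂ e₃).symm
      (hT.homology_exact₃ n (n + 1) hrel)
  · exact ShortComplex.exact_of_iso (ShortComplex.isoMk (c n) (a (n + 1)) (b (n + 1)) e₃
      (e₁ (n + 1))).symm (hT.homology_exact₁ n (n + 1) hrel)

/-- A scalar acts on the right derived functors of a linear functor through its action on the
argument. -/
theorem rightDerived_map_smul_id {R : Type*} [CommRing R] [Linear R C] [Linear R D] (F : C ⥤ D)
    [F.Additive] [F.Linear R] (n : ℕ) (X : C) (r : R) :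
    (F.rightDerived n).map (r • 𝟙 X) = r • 𝟙 _ := by
  let I := InjectiveResolution.of X
  have h := InjectiveResolution.isoRightDerivedObj_hom_naturality (r • 𝟙 X) I I
    (r • 𝟙 I.cocomplex) (by
      change augmentation I ≫ (r • 𝟙 (I.cocomplex.X 0)) = (r • 𝟙 X) ≫ augmentation I
      simp) F n
  rw [← cancel_mono (I.isoRightDerivedObj F n).hom, h]
  have h2 : (F.mapHomologicalComplex (ComplexShape.up ℕ) ⋙
      HomologicalComplex.homologyFunctor D _ n).map (r • 𝟙 I.cocomplex) = r • 𝟙 _ := by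
    rw [Functor.comp_map, Functor.map_smul, CategoryTheory.Functor.map_id]
    exact (ShortComplex.homologyMap_smul (𝟙 _) r).trans
      (congrArg (r • ·) (ShortComplex.homologyMap_id _))
  rw [h2]
  simp

end LongExactSequence

/-! ### Torsion with respect to a pair of ideals -/

section Torsion

variable {R : Type u} [CommRing R] {I J : Ideal R}

/-- In a noetherian ring, `𝔞 ∈ W̃(I,J)` if and only if every prime containing `𝔞 + J`
contains `I`. -/
theorem mem_WTilde_iff [IsNoetherianRing R] {𝔞 : Ideal R} :
    𝔞 ∈ WTilde I J ↔ ∀ q : Ideal R, q.IsPrime → 𝔞 ≤ q → J ≤ q → I ≤ q := by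
  constructor
  · rintro ⟨n, hn⟩ q hq ha hJ
    exact hq.le_of_pow_le (hn.trans (sup_le ha hJ))
  · intro h
    have hrad : I ≤ (𝔞 ⊔ J).radical := by
      rw [Ideal.radical_eq_sInf]
      exact le_sInf fun q hq => h q hq.2 (le_sup_left.trans hq.1) (le_sup_right.trans hq.1)
    exact Ideal.exists_pow_le_of_le_radical_of_fg hrad (IsNoetherian.noetherian I)

theorem top_mem_WTilde : (⊤ : Ideal R) ∈ WTilde I J :=
  ⟨0, by simp⟩

theorem pow_mem_WTilde [IsNoetherianRing R] {𝔞 : Ideal R} (h : 𝔞 ∈ WTilde I J) (n : ℕ) :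
    𝔞 ^ n ∈ WTilde I J := by
  rw [mem_WTilde_iff] at h ⊢
  exact fun q hq ha hJ => h q hq (hq.le_of_pow_le ha) hJ

variable {M N : Type u} [AddCommGroup M] [Module R M] [AddCommGroup N] [Module R N]

theorem mem_gamma_iff {x : M} :
    x ∈ gamma I J M ↔ ∀ p : PrimeSpectrum R, (∀ r : R, r • x = 0 → r ∈ p.asIdeal) → p ∈ W I J := by
  simp_rw [← mem_support_span_singleton_iff]
  rfl

/-- An element killed by a member of `W̃(I,J)` is `(I,J)`-torsion. -/
theorem mem_gamma_of_smul_eq_zero {𝔞 : Ideal R} (h : 𝔞 ∈ WTilde I J) {x : M}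
    (hx : ∀ r ∈ 𝔞, r • x = 0) : x ∈ gamma I J M := by
  rw [mem_gamma_iff]
  intro p hp
  obtain ⟨n, hn⟩ := h
  refine ⟨n + 1, by omega, (Ideal.pow_le_pow_right (Nat.le_succ n)).trans (hn.trans ?_)⟩
  exact sup_le_sup_right (fun r hr => hp r (hx r hr)) J

/-- A finitely generated submodule consisting of `(I,J)`-torsion elements is killed by a member
of `W̃(I,J)`. -/
theorem annihilator_mem_WTilde [IsNoetherianRing R] {L : Submodule R M} (hL : L.FG)
    (h : L ≤ gamma I J M) : L.annihilator ∈ WTilde I J := by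
  rw [mem_WTilde_iff]
  intro q hq ha hJ
  have : Module.Finite R L := Module.Finite.iff_fg.2 hL
  have hq' : (⟨q, hq⟩ : PrimeSpectrum R) ∈ Module.support R L :=
    Module.mem_support_iff_of_finite.2 ha
  obtain ⟨x, hx⟩ := Module.mem_support_iff_exists_annihilator.1 hq'
  obtain ⟨n, -, hn⟩ := mem_gamma_iff.1 (h x.2) ⟨q, hq⟩ fun r hr => hx (by
    rw [Submodule.mem_annihilator_span_singleton]
    exact Subtype.ext hr)
  exact hq.le_of_pow_le (hn.trans (sup_le le_rfl hJ))

theorem gamma_quotient_gamma : gamma I J (M ⧸ gamma I J M) = ⊥ := by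
  rw [eq_bot_iff]
  intro y hy
  obtain ⟨x, rfl⟩ := Submodule.mkQ_surjective _ y
  rw [Submodule.mem_bot, Submodule.mkQ_apply, Submodule.Quotient.mk_eq_zero, mem_gamma_iff]
  intro p hp
  by_contra hpW
  have h1 := mt (mem_gamma_iff.1 hy p) hpW
  push Not at h1
  obtain ⟨r, hr, hrp⟩ := h1
  rw [← map_smul, Submodule.mkQ_apply, Submodule.Quotient.mk_eq_zero] at hr
  have h2 := mt (mem_gamma_iff.1 hr p) hpW
  push Not at h2
  obtain ⟨s, hs, hsp⟩ := h2
  exact (p.isPrime.mem_or_mem (hp (s * r) (by rwa [mul_smul]))).elim hsp hrp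

/-- Over a noetherian ring, the torsion submodule of an injective module is injective. By the
Artin–Rees lemma a map from an ideal to `Γ_{I,J}(E)` kills the intersection of that ideal with some
member of `W̃(I,J)`, so its extension to `R` can be chosen to kill that member. -/
theorem injective_gamma [IsNoetherianRing R] (E : Type u) [AddCommGroup E] [Module R E]
    [Module.Injective R E] : Module.Injective R (gamma I J E) := by
  refine Module.Baer.injective fun b f => ?_
  have hb : b.FG := IsNoetherian.noetherian b
  have : Module.Finite R b := Module.Finite.iff_fg.2 hb
  let g : b →ₗ[R] E := (gamma I J E).subtype ∘ₗ f
  have hg : LinearMap.range g ≤ gamma I J E := by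
    rintro _ ⟨x, rfl⟩
    exact (f x).2
  let 𝔞 : Ideal R := (LinearMap.range g).annihilator
  have h𝔞 : 𝔞 ∈ WTilde I J := annihilator_mem_WTilde (Module.Finite.iff_fg.1 inferInstance) hg
  -- Artin–Rees: `𝔞 ^ (k + 1) ⊓ b ≤ 𝔞 • b`, which `g` kills
  obtain ⟨k, hk⟩ := 𝔞.exists_pow_inf_eq_pow_smul b
  have hkill (x : b) (hx : (x : R) ∈ 𝔞 ^ (k + 1)) : g x = 0 := by
    have h1 : 𝔞 • b ≤ (LinearMap.ker g).map b.subtype := by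
      refine Submodule.smul_le.2 fun r hr n hn => ⟨r • ⟨n, hn⟩, ?_, rfl⟩
      rw [SetLike.mem_coe, LinearMap.mem_ker, map_smul]
      exact Submodule.mem_annihilator.1 hr _ ⟨_, rfl⟩
    have h2 : (x : R) ∈ 𝔞 ^ (k + 1) • (⊤ : Ideal R) ⊓ b := ⟨by simpa using hx, x.2⟩
    rw [hk (k + 1) (Nat.le_succ k), Nat.add_sub_cancel_left, pow_one] at h2
    obtain ⟨y, hy, hyx⟩ := h1 (Submodule.smul_mono le_rfl inf_le_right h2)
    rwa [← Subtype.ext hyx]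
  let π : b →ₗ[R] R ⧸ 𝔞 ^ (k + 1) := (Submodule.mkQ (𝔞 ^ (k + 1))) ∘ₗ b.subtype
  have hker : LinearMap.ker π ≤ LinearMap.ker g := by
    intro x hx
    refine hkill x ?_
    exact (Submodule.Quotient.mk_eq_zero _).1 hx
  obtain ⟨h, hh⟩ := Module.Injective.out ((LinearMap.ker π).liftQ π le_rfl)
    (LinearMap.ker_eq_bot.1 (Submodule.ker_liftQ_eq_bot _ _ _ le_rfl))
    ((LinearMap.ker π).liftQ g hker)
  let h' : R →ₗ[R] E := h ∘ₗ Submodule.mkQ (𝔞 ^ (k + 1))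
  have hmem (r : R) : h' r ∈ gamma I J E := by
    refine mem_gamma_of_smul_eq_zero (pow_mem_WTilde h𝔞 (k + 1)) fun s hs => ?_
    have : Submodule.mkQ (𝔞 ^ (k + 1)) (s • r) = 0 := by
      rw [Submodule.mkQ_apply, Submodule.Quotient.mk_eq_zero]
      exact Ideal.mul_mem_right r _ hs
    rw [← map_smul, LinearMap.comp_apply, this, map_zero]
  refine ⟨h'.codRestrict _ hmem, fun x hx => Subtype.ext ?_⟩
  exact hh (Submodule.Quotient.mk ⟨x, hx⟩)

end Torsion

/-! ### ZD-modules -/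

section ZeroDivisors

variable {R : Type u} [CommRing R] {M : Type u} [AddCommGroup M] [Module R M]

theorem exists_ne_zero_of_isAssociatedPrime [IsNoetherianRing R] {p : Ideal R}
    (hp : IsAssociatedPrime p M) : ∃ x : M, x ≠ 0 ∧ ∀ r : R, r ∈ p ↔ r • x = 0 := by
  obtain ⟨hprime, x, rfl⟩ := isAssociatedPrime_iff.1 hp
  refine ⟨x, ?_, fun r => by simp [Submodule.mem_colon_singleton]⟩
  rintro rfl
  exact hprime.ne_top (by simp)

theorem IsZDModule.of_surjective {N : Type u} [AddCommGroup N] [Module R N]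
    (h : IsZDModule R M) (f : M →ₗ[R] N) (hf : Function.Surjective f) : IsZDModule R N := by
  intro L
  let e : (M ⧸ L.comap f) ≃ₗ[R] (N ⧸ L) :=
    LinearEquiv.ofBijective (Submodule.mapQ _ L f le_rfl) (by
      constructor
      · rw [← LinearMap.ker_eq_bot, Submodule.ker_mapQ]
        simp [Submodule.mkQ_map_self]
      · rw [← LinearMap.range_eq_top, Submodule.range_mapQ, LinearMap.range_eq_top.2 hf]
        simp)
  obtain ⟨s, hs, hsub, heq⟩ := h (L.comap f)
  refine ⟨s, hs, fun p hp => e.isAssociatedPrime_iff.1 (hsub hp), ?_⟩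
  rw [← heq]
  ext r
  constructor
  · rintro ⟨x, hx, hr⟩
    exact ⟨e.symm x, by simpa using hx, by rw [← map_smul, hr, map_zero]⟩
  · rintro ⟨x, hx, hr⟩
    exact ⟨e x, by simpa using hx, by rw [← map_smul, hr, map_zero]⟩

/-- If a ZD-module has no `(I,J)`-torsion, then every member of `W̃(I,J)` contains an element that
is regular on it: otherwise, by prime avoidance, it lies in the annihilator of a nonzero element. -/
theorem exists_isSMulRegular [IsNoetherianRing R] {I J : Ideal R} (h : IsZDModule R M)
    (hM : gamma I J M = ⊥) {𝔞 : Ideal R} (h𝔞 : 𝔞 ∈ WTilde I J) : ∃ x ∈ 𝔞, IsSMulRegular M x := by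
  by_contra! hcon
  obtain ⟨s, hs, hsub, heq⟩ := h ⊥
  let e : (M ⧸ (⊥ : Submodule R M)) ≃ₗ[R] M := Submodule.quotEquivOfEqBot _ rfl
  have hle : (𝔞 : Set R) ⊆ ⋃ p ∈ s, (p : Set R) := by
    intro r hr
    rw [← heq]
    have hr' := hcon r hr
    rw [isSMulRegular_iff_right_eq_zero_of_smul] at hr'
    push Not at hr'
    obtain ⟨x, hx, hx0⟩ := hr'
    exact ⟨e.symm x, by simpa using hx0, by rw [← map_smul, hx, map_zero]⟩
  obtain ⟨p, hps, hp⟩ := (Ideal.subset_union_prime_finite hs (f := id) ⊤ ⊤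
    fun p hp _ _ => (hsub hp).isPrime).1 hle
  obtain ⟨z, hz0, hz⟩ := exists_ne_zero_of_isAssociatedPrime (e.isAssociatedPrime_iff.1 (hsub hps))
  have hzγ : z ∈ gamma I J M := mem_gamma_of_smul_eq_zero h𝔞 fun r hr => (hz r).1 (hp hr)
  rw [hM, Submodule.mem_bot] at hzγ
  exact hz0 hzγ

end ZeroDivisors

/-! ### Dimension modulo a regular element -/

section Dimension

variable {R : Type u} [CommRing R] [IsNoetherianRing R] {M : Type u} [AddCommGroup M] [Module R M]

/-- A prime of the support that contains a regular element is not minimal in the support: a minimal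
one would be an associated prime. -/
theorem exists_mem_support_lt_of_isSMulRegular {x : R} (hx : IsSMulRegular M x)
    {p : PrimeSpectrum R} (hp : p ∈ Module.support R M) (hxp : x ∈ p.asIdeal) :
    ∃ q ∈ Module.support R M, q < p := by
  obtain ⟨m, hm⟩ := Module.mem_support_iff_exists_annihilator.1 hp
  obtain ⟨q, hq, hqp⟩ := Ideal.exists_minimalPrimes_le hm
  have hass : q ∈ associatedPrimes R (Submodule.span R {m}) :=
    Module.associatedPrimes.minimalPrimes_annihilator_subset_associatedPrimes R _ hq
  refine ⟨⟨q, hq.isPrime⟩, Module.mem_support_iff_exists_annihilator.2 ⟨m, hq.1.2⟩,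
    lt_of_le_of_ne hqp ?_⟩
  rintro rfl
  obtain ⟨z, hz0, hz⟩ := exists_ne_zero_of_isAssociatedPrime hass
  have hxz := congrArg Subtype.val ((hz x).1 hxp)
  exact hz0 (Subtype.ext (isSMulRegular_iff_right_eq_zero_of_smul.1 hx _ hxz))

/-- Dividing out a regular element lowers the dimension. -/
theorem supportDim_quotient_range_lsmul_add_one_le {x : R} (hx : IsSMulRegular M x) :
    Module.supportDim R (M ⧸ LinearMap.range (LinearMap.lsmul R M x)) + 1 ≤
      Module.supportDim R M := by
  set Q := M ⧸ LinearMap.range (LinearMap.lsmul R M x)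
  have hle : Module.support R Q ⊆ Module.support R M :=
    Module.support_subset_of_surjective (Submodule.mkQ _) (Submodule.mkQ_surjective _)
  have hxQ (p : PrimeSpectrum R) (hp : p ∈ Module.support R Q) : x ∈ p.asIdeal := by
    obtain ⟨m, hm⟩ := Module.mem_support_iff_exists_annihilator.1 hp
    refine hm ?_
    rw [Submodule.mem_annihilator_span_singleton]
    obtain ⟨m, rfl⟩ := Submodule.mkQ_surjective _ m
    rw [← map_smul, Submodule.mkQ_apply, Submodule.Quotient.mk_eq_zero]
    exact ⟨m, rfl⟩
  cases subsingleton_or_nontrivial Q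
  · simp [Module.supportDim_eq_bot_of_subsingleton]
  have : Nonempty (Module.support R Q) := Module.nonempty_support_of_nontrivial.to_subtype
  have : Nonempty (Module.support R M) := this.map (Set.inclusion hle)
  simp only [Module.supportDim, Order.krullDim_eq_iSup_length]
  apply WithBot.coe_le_coe.mpr
  simp only [ENat.iSup_add, iSup_le_iff]
  intro p
  let q : LTSeries (Module.support R M) := p.map (Set.inclusion hle) (fun _ _ h ↦ h)
  obtain ⟨r, hrm, hr⟩ := exists_mem_support_lt_of_isSMulRegular hx q.head.2 (hxQ _ p.head.2)
  exact le_of_eq_of_le (by simp [q]; rfl) (le_iSup _ (q.cons ⟨r, hrm⟩ hr))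

end Dimension

/-! ### Serre classes of modules -/

section SerreProperty

variable {R : Type u} [CommRing R]

/-- A property of `R`-modules whose members form a Serre class: it holds for the zero module and,
for an exact sequence `A → B → C`, passes from `A` and `C` to `B`. This single closure condition
covers submodules, quotients and extensions. -/
structure IsSerreProperty (P : ∀ (N : Type u) [AddCommGroup N] [Module R N], Prop) : Prop where
  punit : P PUnit
  of_exact : ∀ {A B C : Type u} [AddCommGroup A] [Module R A] [AddCommGroup B] [Module R B]
    [AddCommGroup C] [Module R C] (f : A →ₗ[R] B) (g : B →ₗ[R] C),
    LinearMap.range f = LinearMap.ker g → P A → P C → P B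

theorem isSerreProperty_finite [IsNoetherianRing R] :
    IsSerreProperty (R := R) fun N _ _ => Module.Finite R N where
  punit := inferInstance
  of_exact f g h hA hC := by
    have := isNoetherian_of_range_eq_ker f g h
    infer_instance

theorem isSerreProperty_isArtinian : IsSerreProperty (R := R) fun N _ _ => IsArtinian R N where
  punit := inferInstance
  of_exact f g h _ _ := isArtinian_of_range_eq_ker f g h

theorem isSerreProperty_subsingleton : IsSerreProperty (R := R) fun N _ _ => Subsingleton N where
  punit := inferInstance
  of_exact f g h _ _ := by
    refine subsingleton_of_forall_eq 0 fun y => ?_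
    obtain ⟨x, rfl⟩ : y ∈ LinearMap.range f := h ▸ Subsingleton.elim (g y) 0
    rw [Subsingleton.elim x 0, map_zero]

namespace IsSerreProperty

variable {P : ∀ (N : Type u) [AddCommGroup N] [Module R N], Prop} (hP : IsSerreProperty P)
  {M N : Type u} [AddCommGroup M] [Module R M] [AddCommGroup N] [Module R N]
include hP

theorem of_injective (f : M →ₗ[R] N) (hf : Function.Injective f) (h : P N) : P M :=
  hP.of_exact (0 : PUnit.{u + 1} →ₗ[R] M) f
    (by rw [LinearMap.range_zero, LinearMap.ker_eq_bot.2 hf]) hP.punit h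

theorem of_surjective (f : M →ₗ[R] N) (hf : Function.Surjective f) (h : P M) : P N :=
  hP.of_exact f (0 : N →ₗ[R] PUnit.{u + 1})
    (by rw [LinearMap.ker_zero, LinearMap.range_eq_top.2 hf]) h hP.punit

theorem of_subsingleton [Subsingleton M] : P M :=
  hP.of_injective (0 : M →ₗ[R] PUnit.{u + 1}) (Function.injective_of_subsingleton _) hP.punit

theorem pi (r : ℕ) (h : P M) : P (Fin r → M) := by
  induction r with
  | zero => exact hP.of_subsingleton
  | succ r ih =>
    refine hP.of_exact (LinearMap.single R (fun _ : Fin (r + 1) => M) 0)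
      (LinearMap.funLeft R M (Fin.succ : Fin r → Fin (r + 1))) ?_ h ih
    ext x
    simp only [LinearMap.mem_range, LinearMap.mem_ker]
    constructor
    · rintro ⟨y, rfl⟩
      ext i
      simp [LinearMap.funLeft_apply]
    · intro hx
      refine ⟨x 0, ?_⟩
      ext i
      refine Fin.cases (by simp) (fun j => ?_) i
      simpa [LinearMap.funLeft_apply] using (congrFun hx j).symm

/-- If `M / A` has a Serre property and `𝔞 A ⊆ L`, then so does the image of `𝔞 M` in `M / L`: it
is a quotient of a finite power of `M / A`, as `𝔞` is finitely generated. -/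
theorem map_mkQ_smul_top {𝔞 : Ideal R} (h𝔞 : 𝔞.FG) (A L : Submodule R M) (hAL : 𝔞 • A ≤ L)
    (h : P (M ⧸ A)) : P ((𝔞 • (⊤ : Submodule R M)).map L.mkQ) := by
  obtain ⟨r, v, rfl⟩ := Submodule.fg_iff_exists_fin_generating_family.1 h𝔞
  have hv (i : Fin r) : A ≤ L.comap (v i • LinearMap.id) := fun x hx =>
    hAL (Submodule.smul_mem_smul (Submodule.subset_span ⟨i, rfl⟩) hx)
  let φ : (Fin r → M ⧸ A) →ₗ[R] M ⧸ L :=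
    LinearMap.lsum R (fun _ => M ⧸ A) R fun i => A.mapQ L (v i • LinearMap.id) (hv i)
  have hφ (i : Fin r) (x : M) : φ (Pi.single i (A.mkQ x)) = L.mkQ (v i • x) := by
    exact LinearMap.lsum_piSingle R _ _ _ i _
  have hrange : (Submodule.span R (Set.range v) • (⊤ : Submodule R M)).map L.mkQ ≤
      LinearMap.range φ := by
    rw [Submodule.map_le_iff_le_comap, Submodule.smul_le]
    intro s hs x _
    induction hs using Submodule.span_induction with
    | mem s hs =>
      obtain ⟨i, rfl⟩ := hs
      exact ⟨_, hφ i x⟩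
    | zero => simp
    | add s t _ _ hs ht =>
      rw [add_smul]
      exact add_mem hs ht
    | smul c s _ hs =>
      rw [smul_assoc]
      exact Submodule.smul_mem _ _ hs
  exact hP.of_injective (Submodule.inclusion hrange) (Submodule.inclusion_injective _)
    (hP.of_surjective φ.rangeRestrict φ.surjective_rangeRestrict (hP.pi r h))

/-- If `M / (0 :_M 𝔞)` has a Serre property, then so does `𝔞 M`. -/
theorem smul_top_of_quotient_torsionBySet {𝔞 : Ideal R} (h𝔞 : 𝔞.FG)
    (h : P (M ⧸ Submodule.torsionBySet R M (𝔞 : Set R))) : P ↥(𝔞 • (⊤ : Submodule R M)) := by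
  have h1 := hP.map_mkQ_smul_top h𝔞 _ ⊥ (Submodule.smul_le.2 fun r hr x hx => by
    simpa using (Submodule.mem_torsionBySet_iff _ _).1 hx ⟨r, hr⟩) h
  refine hP.of_injective ((Submodule.mkQ ⊥).submoduleMap (𝔞 • (⊤ : Submodule R M))) ?_ h1
  refine fun x y hxy => Subtype.ext ?_
  have h2 := congrArg Subtype.val hxy
  simpa [Submodule.Quotient.eq, sub_eq_zero] using h2

/-- Transfer of the Serre property from `N / 𝔞 N` to `M / 𝔞 M` along a map `M → N` whose kernel
lies in `𝔞 M` and whose cokernel has the property. -/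
theorem quotient_smul_top {𝔞 : Ideal R} (h𝔞 : 𝔞.FG) (f : M →ₗ[R] N)
    (hker : LinearMap.ker f ≤ 𝔞 • (⊤ : Submodule R M)) (hcoker : P (N ⧸ LinearMap.range f))
    (h : P (N ⧸ 𝔞 • (⊤ : Submodule R N))) : P (M ⧸ 𝔞 • (⊤ : Submodule R M)) := by
  let L : Submodule R N := (𝔞 • (⊤ : Submodule R M)).map f
  have hL : L = 𝔞 • LinearMap.range f := by
    rw [LinearMap.range_eq_map, ← Submodule.map_smul'']
  have hLtop : L ≤ 𝔞 • (⊤ : Submodule R N) := hL ▸ Submodule.smul_mono le_rfl le_top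
  have hNL : P (N ⧸ L) := by
    refine hP.of_exact (Submodule.subtype _) (Submodule.factor hLtop) ?_
      (hP.map_mkQ_smul_top h𝔞 (LinearMap.range f) L hL.ge hcoker) h
    rw [Submodule.range_subtype]
    ext y
    obtain ⟨y, rfl⟩ := Submodule.mkQ_surjective _ y
    rw [LinearMap.mem_ker, Submodule.factor_mk, Submodule.mkQ_apply (𝔞 • ⊤) y,
      Submodule.Quotient.mk_eq_zero]
    constructor
    · rintro ⟨z, hz, hzy⟩
      exact (Submodule.sub_mem_iff_right _ hz).1 (hLtop ((Submodule.Quotient.eq L).1 hzy))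
    · exact fun hy => ⟨y, hy, rfl⟩
  refine hP.of_injective (Submodule.mapQ _ L f (Submodule.le_comap_map _ _)) ?_ hNL
  rw [← LinearMap.ker_eq_bot, Submodule.ker_mapQ, Submodule.comap_map_eq, sup_eq_left.2 hker,
    Submodule.mkQ_map_self]

end IsSerreProperty

end SerreProperty

/-! ### Local cohomology with respect to a pair of ideals -/

section LocalCohomology

variable {R : Type u} [CommRing R] {I J : Ideal R}

theorem mem_gamma_of_injective {M N : Type u} [AddCommGroup M] [Module R M] [AddCommGroup N]
    [Module R N] (f : M →ₗ[R] N) (hf : Function.Injective f) {x : M} (hx : f x ∈ gamma I J N) :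
    x ∈ gamma I J M := by
  rw [mem_gamma_iff] at hx ⊢
  exact fun p hp => hx p fun r hr => hp r (hf (by rw [map_smul, hr, map_zero]))

theorem gamma_eq_top_of_surjective {M N : Type u} [AddCommGroup M] [Module R M] [AddCommGroup N]
    [Module R N] (f : M →ₗ[R] N) (hf : Function.Surjective f) (h : gamma I J M = ⊤) :
    gamma I J N = ⊤ := by
  rw [eq_top_iff]
  intro y _
  obtain ⟨x, rfl⟩ := hf y
  exact map_mem_gamma I J f x (h ▸ Submodule.mem_top)

theorem gamma_gamma {M : Type u} [AddCommGroup M] [Module R M] :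
    gamma I J (gamma I J M) = ⊤ :=
  eq_top_iff.2 fun x _ => mem_gamma_of_injective (Submodule.subtype _) Subtype.val_injective x.2

instance : (gammaFunctor I J).Linear R where

instance : PreservesFiniteLimits (gammaFunctor I J) := by
  rw [Functor.preservesFiniteLimits_iff_forall_exact_map_and_mono]
  intro S hS
  have hinj : Function.Injective S.f := (ModuleCat.mono_iff_injective _).1 hS.mono_f
  constructor
  · rw [ShortComplex.moduleCat_exact_iff]
    intro x hx
    obtain ⟨y, hy⟩ := (ShortComplex.moduleCat_exact_iff _).1 hS.exact x.1 (congrArg Subtype.val hx)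
    exact ⟨⟨y, mem_gamma_of_injective S.f.hom hinj (by
      change S.f y ∈ _
      rw [hy]
      exact x.2)⟩, Subtype.ext hy⟩
  · rw [ModuleCat.mono_iff_injective]
    exact fun x y hxy => Subtype.ext (hinj (congrArg Subtype.val hxy))

variable {A B C : Type u} [AddCommGroup A] [Module R A] [AddCommGroup B] [Module R B]
  [AddCommGroup C] [Module R C]

variable (I J) in
/-- The map induced by a linear map on local cohomology. -/
noncomputable def Hmap (i : ℕ) (f : A →ₗ[R] B) : H I J i A →ₗ[R] H I J i B :=
  (((gammaFunctor I J).rightDerived i).map (ModuleCat.ofHom f)).hom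

theorem Hmap_lsmul (i : ℕ) (r : R) (y : H I J i A) :
    Hmap I J i (LinearMap.lsmul R A r) y = r • y := by
  have h := rightDerived_map_smul_id (gammaFunctor I J) i (ModuleCat.of R A) r
  have h2 : ModuleCat.ofHom (LinearMap.lsmul R A r) = r • 𝟙 (ModuleCat.of R A) := rfl
  rw [Hmap, h2, h]
  rfl

/-- The long exact sequence of local cohomology. -/
theorem exists_H_exact {f : A →ₗ[R] B} {g : B →ₗ[R] C} (hf : Function.Injective f)
    (hg : Function.Surjective g) (h : LinearMap.range f = LinearMap.ker g) (i : ℕ) :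
    ∃ δ : H I J i C →ₗ[R] H I J (i + 1) A,
      LinearMap.range (Hmap I J i f) = LinearMap.ker (Hmap I J i g) ∧
      LinearMap.range (Hmap I J i g) = LinearMap.ker δ ∧
      LinearMap.range δ = LinearMap.ker (Hmap I J (i + 1) f) := by
  let S : ShortComplex (ModuleCat.{u} R) := ShortComplex.mk (ModuleCat.ofHom f) (ModuleCat.ofHom g)
    (by
      ext x
      exact h.le ⟨x, rfl⟩)
  have hS : S.ShortExact :=
    { exact := ShortComplex.Exact.moduleCat_of_range_eq_ker _ _ h
      mono_f := (ModuleCat.mono_iff_injective _).2 hf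
      epi_g := (ModuleCat.epi_iff_surjective _).2 hg }
  obtain ⟨δ, w₂, w₃, w₁, h₂, h₃, h₁⟩ := exists_rightDerived_exact (gammaFunctor I J) hS i
  exact ⟨δ.hom, h₂.moduleCat_range_eq_ker, h₃.moduleCat_range_eq_ker, h₁.moduleCat_range_eq_ker⟩

theorem subsingleton_H_of_subsingleton [Subsingleton A] (i : ℕ) : Subsingleton (H I J i A) := by
  refine subsingleton_of_forall_eq 0 fun y => ?_
  have h : LinearMap.lsmul R A 0 = LinearMap.lsmul R A 1 := by
    ext x
    exact Subsingleton.elim _ _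
  rw [← one_smul R y, ← Hmap_lsmul, ← h, Hmap_lsmul, zero_smul]

/-- Local cohomology modules consist of torsion elements. -/
theorem gamma_H (i : ℕ) : gamma I J (H I J i A) = ⊤ := by
  let P := InjectiveResolution.of (ModuleCat.of R A)
  let K := ((gammaFunctor I J).mapHomologicalComplex (ComplexShape.up ℕ)).obj P.cocomplex
  let e : H I J i A ≅ K.homology i := P.isoRightDerivedObj (gammaFunctor I J) i
  have h1 : gamma I J (K.X i) = ⊤ := gamma_gamma (M := P.cocomplex.X i)
  have h2 : gamma I J (K.cycles i) = ⊤ := eq_top_iff.2 fun x _ =>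
    mem_gamma_of_injective (K.iCycles i).hom ((ModuleCat.mono_iff_injective _).1 inferInstance)
      (h1 ▸ Submodule.mem_top)
  refine gamma_eq_top_of_surjective (K.homologyπ i ≫ e.inv).hom ?_ h2
  exact (ModuleCat.epi_iff_surjective _).1 inferInstance

theorem subsingleton_H_succ_of_injective [Module.Injective R A] (i : ℕ) :
    Subsingleton (H I J (i + 1) A) := by
  have : Injective (ModuleCat.of R A) := (Module.injective_iff_injective_object R A).1 inferInstance
  exact ModuleCat.subsingleton_of_isZero
    ((gammaFunctor I J).isZero_rightDerived_obj_injective_succ i (ModuleCat.of R A))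

/-- In degree `0`, a surjection out of a torsion module stays surjective, as `H⁰` is `Γ_{I,J}`. -/
theorem Hmap_zero_surjective (hA : gamma I J A = ⊤) (f : A →ₗ[R] B) (hf : Function.Surjective f) :
    Function.Surjective (Hmap I J 0 f) := by
  have h1 : Epi ((gammaFunctor I J).map (ModuleCat.ofHom f)) := by
    rw [ModuleCat.epi_iff_surjective]
    intro y
    obtain ⟨x, hx⟩ := hf y.1
    exact ⟨⟨x, hA ▸ Submodule.mem_top⟩, Subtype.ext hx⟩
  have h2 : Epi (((gammaFunctor I J).rightDerived 0).map (ModuleCat.ofHom f)) := by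
    have := (gammaFunctor I J).rightDerivedZeroIsoSelf.hom.naturality (ModuleCat.ofHom f)
    rw [← NatIso.naturality_2 (gammaFunctor I J).rightDerivedZeroIsoSelf]
    infer_instance
  exact (ModuleCat.epi_iff_surjective _).1 h2

/-- Over a noetherian ring, `(I,J)`-torsion modules are acyclic. -/
theorem subsingleton_H_succ_of_gamma_eq_top [IsNoetherianRing R] (i : ℕ) :
    ∀ (A : Type u) [AddCommGroup A] [Module R A], gamma I J A = ⊤ →
      Subsingleton (H I J (i + 1) A) := by
  induction i with
  | zero => ?_
  | succ i ih => ?_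
  all_goals
    intro A _ _ hA
    let E := Injective.under (ModuleCat.of R A)
    have hE : Injective (ModuleCat.of R E) :=
      inferInstanceAs (Injective (Injective.under (ModuleCat.of R A)))
    -- `A` embeds into the injective torsion module `Γ_{I,J}(E)`
    have : Module.Injective R E := (Module.injective_iff_injective_object R E).2 hE
    let ι : A →ₗ[R] E := (Injective.ι (ModuleCat.of R A)).hom
    have hι : Function.Injective ι := (ModuleCat.mono_iff_injective _).1 inferInstance
    have := injective_gamma (I := I) (J := J) E
    let f : A →ₗ[R] gamma I J E := ι.codRestrict _ fun x =>
      map_mem_gamma I J ι x (hA ▸ Submodule.mem_top)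
    have hf : Function.Injective f := fun x y hxy => hι (congrArg Subtype.val hxy)
    let g := (LinearMap.range f).mkQ
    have hg : Function.Surjective g := Submodule.mkQ_surjective _
    have hC : gamma I J (gamma I J E ⧸ LinearMap.range f) = ⊤ :=
      gamma_eq_top_of_surjective g hg gamma_gamma
  · obtain ⟨δ, -, h₃, h₁⟩ := exists_H_exact (I := I) (J := J) hf hg (by simp [g]) 0
    have := subsingleton_H_succ_of_injective (I := I) (J := J) (A := gamma I J E) 0
    refine subsingleton_of_forall_eq 0 fun y => ?_
    obtain ⟨z, rfl⟩ : y ∈ LinearMap.range δ := h₁ ▸ Subsingleton.elim _ _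
    exact h₃.le (Hmap_zero_surjective gamma_gamma g hg z)
  · obtain ⟨δ, -, h₃, h₁⟩ := exists_H_exact (I := I) (J := J) hf hg (by simp [g]) (i + 1)
    have := subsingleton_H_succ_of_injective (I := I) (J := J) (A := gamma I J E) (i + 1)
    have := ih _ hC
    refine subsingleton_of_forall_eq 0 fun y => ?_
    obtain ⟨z, rfl⟩ : y ∈ LinearMap.range δ := h₁ ▸ Subsingleton.elim _ _
    rw [Subsingleton.elim z 0, map_zero]

/-- In positive degrees, passing to `A / Γ_{I,J}(A)` does not change local cohomology, as the
torsion submodule is acyclic. -/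
theorem nonempty_H_succ_equiv_quotient_gamma [IsNoetherianRing R] (i : ℕ) :
    Nonempty (H I J (i + 1) A ≃ₗ[R] H I J (i + 1) (A ⧸ gamma I J A)) := by
  have hex (j : ℕ) := exists_H_exact (I := I) (J := J) (gamma I J A).injective_subtype
    (gamma I J A).mkQ_surjective (by simp) j
  have hz (j : ℕ) := subsingleton_H_succ_of_gamma_eq_top (I := I) (J := J) j (gamma I J A)
    gamma_gamma
  obtain ⟨δ, h₂, h₃, -⟩ := hex (i + 1)
  have := hz i
  have := hz (i + 1)
  refine ⟨LinearEquiv.ofBijective (Hmap I J (i + 1) (gamma I J A).mkQ) ⟨?_, fun y => ?_⟩⟩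
  · rw [← LinearMap.ker_eq_bot, ← h₂, LinearMap.range_eq_bot]
    exact LinearMap.ext fun x => by rw [Subsingleton.elim x 0, map_zero, map_zero]
  · exact h₃.ge (Subsingleton.elim _ _)

end LocalCohomology

/-! ### Serre classes and local cohomology of ZD-modules -/

section ZDModules

variable {R : Type u} [CommRing R] {I J : Ideal R}

theorem lt_natCast_of_add_one_le {a b : WithBot ℕ∞} {d : ℕ} (hab : a + 1 ≤ b)
    (hb : b < ((d + 1 : ℕ) : WithBot ℕ∞)) : a < (d : WithBot ℕ∞) := by
  have h := hab.trans_lt hb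
  rw [Nat.cast_add, Nat.cast_one] at h
  exact lt_of_add_lt_add_right h

theorem subsingleton_of_supportDim_lt_zero {M : Type u} [AddCommGroup M] [Module R M]
    (h : Module.supportDim R M < ((0 : ℕ) : WithBot ℕ∞)) : Subsingleton M := by
  by_contra hM
  rw [not_subsingleton_iff_nontrivial] at hM
  have : Nonempty (Module.support R M) := Module.nonempty_support_of_nontrivial.to_subtype
  exact absurd Order.krullDim_nonneg (not_le_of_gt (by simpa [Module.supportDim] using h))

/-- If `x` is regular on `M`, then a Serre property of `Hⁱ(M)` and `Hⁱ⁺¹(M)` passes to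
`Hⁱ(M / x M)`. -/
theorem IsSerreProperty.H_quotient_range_lsmul
    {P : ∀ (N : Type u) [AddCommGroup N] [Module R N], Prop} (hP : IsSerreProperty P)
    {M : Type u} [AddCommGroup M] [Module R M] {x : R} (hx : IsSMulRegular M x) (i : ℕ)
    (h₁ : P (H I J i M)) (h₂ : P (H I J (i + 1) M)) :
    P (H I J i (M ⧸ LinearMap.range (LinearMap.lsmul R M x))) := by
  obtain ⟨δ, -, h, -⟩ := exists_H_exact (I := I) (J := J) (f := LinearMap.lsmul R M x) hx
    (Submodule.mkQ_surjective _) (Submodule.ker_mkQ _).symm i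
  exact hP.of_exact _ δ h h₁ h₂

variable [IsNoetherianRing R]

/-- Let `x ∈ 𝔞` be regular on `M` and let `Hⁱ⁺¹(M)` lie in a Serre class. If the class contains
`Hⁱ(M / x M)` modulo `𝔞`, then it contains `Hⁱ(M)` modulo `𝔞`. -/
theorem IsSerreProperty.H_quotient_smul_top_of_isSMulRegular
    {P : ∀ (N : Type u) [AddCommGroup N] [Module R N], Prop} (hP : IsSerreProperty P)
    {M : Type u} [AddCommGroup M] [Module R M] {𝔞 : Ideal R} {x : R} (hx𝔞 : x ∈ 𝔞)
    (hx : IsSMulRegular M x) (i : ℕ) (h : P (H I J (i + 1) M))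
    (hQ : P (H I J i (M ⧸ LinearMap.range (LinearMap.lsmul R M x)) ⧸ 𝔞 •
      (⊤ : Submodule R (H I J i (M ⧸ LinearMap.range (LinearMap.lsmul R M x)))))) :
    P (H I J i M ⧸ 𝔞 • (⊤ : Submodule R (H I J i M))) := by
  obtain ⟨δ, h₂, h₃, -⟩ := exists_H_exact (I := I) (J := J) (f := LinearMap.lsmul R M x) hx
    (Submodule.mkQ_surjective _) (Submodule.ker_mkQ _).symm i
  refine hP.quotient_smul_top (IsNoetherian.noetherian 𝔞)
    (Hmap I J i (LinearMap.range (LinearMap.lsmul R M x)).mkQ) ?_ ?_ hQ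
  · rw [← h₂]
    rintro _ ⟨y, rfl⟩
    rw [Hmap_lsmul]
    exact Submodule.smul_mem_smul hx𝔞 Submodule.mem_top
  · exact hP.of_injective (Submodule.liftQ _ δ h₃.le)
      (LinearMap.ker_eq_bot.1 (Submodule.ker_liftQ_eq_bot _ _ _ h₃.ge)) h

/-- Let `M` be a ZD-module of finite dimension. If `Hⁱ(M)` belongs to a Serre class for all `i > n`,
where `n ≥ 1`, then `Hⁿ(M) / 𝔞 Hⁿ(M)` belongs to it for every `𝔞 ∈ W̃(I,J)`. The proof is by
induction on the dimension: after replacing `M` by `M / Γ_{I,J}(M)` one divides out an `M`-regular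
element of `𝔞`. -/
theorem IsSerreProperty.H_quotient_smul_top
    {P : ∀ (N : Type u) [AddCommGroup N] [Module R N], Prop} (hP : IsSerreProperty P)
    {𝔞 : Ideal R} (h𝔞 : 𝔞 ∈ WTilde I J) (n d : ℕ) :
    ∀ (M : Type u) [AddCommGroup M] [Module R M], IsZDModule R M →
      Module.supportDim R M < (d : WithBot ℕ∞) → (∀ i, n + 1 < i → P (H I J i M)) →
      P (H I J (n + 1) M ⧸ 𝔞 • (⊤ : Submodule R (H I J (n + 1) M))) := by
  have hfg : 𝔞.FG := IsNoetherian.noetherian 𝔞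
  induction d with
  | zero =>
    intro M _ _ _ hd _
    have : Subsingleton M := subsingleton_of_supportDim_lt_zero hd
    have := subsingleton_H_of_subsingleton (I := I) (J := J) (A := M) (n + 1)
    exact hP.of_subsingleton
  | succ d ih =>
    intro M _ _ hZD hd hH
    have hZD' : IsZDModule R (M ⧸ gamma I J M) :=
      hZD.of_surjective _ (Submodule.mkQ_surjective _)
    have hd' := (Module.supportDim_le_of_surjective _ (gamma I J M).mkQ_surjective).trans_lt hd
    have hH' (i : ℕ) (hi : n + 1 < i) : P (H I J i (M ⧸ gamma I J M)) := by
      obtain ⟨i, rfl⟩ : ∃ k, i = k + 1 := ⟨i - 1, by omega⟩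
      obtain ⟨e⟩ := nonempty_H_succ_equiv_quotient_gamma (I := I) (J := J) (A := M) i
      exact hP.of_surjective e.toLinearMap e.surjective (hH _ hi)
    obtain ⟨e⟩ := nonempty_H_succ_equiv_quotient_gamma (I := I) (J := J) (A := M) n
    refine hP.quotient_smul_top hfg e.toLinearMap (by simp) ?_ ?_
    · have : Subsingleton (H I J (n + 1) (M ⧸ gamma I J M) ⧸ LinearMap.range e.toLinearMap) := by
        rw [LinearEquiv.range]
        infer_instance
      exact hP.of_subsingleton
    obtain ⟨x, hx𝔞, hx⟩ := exists_isSMulRegular hZD' gamma_quotient_gamma h𝔞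
    refine hP.H_quotient_smul_top_of_isSMulRegular hx𝔞 hx (n + 1) (hH' _ (Nat.lt_succ_self _)) ?_
    exact ih _ (hZD'.of_surjective _ (Submodule.mkQ_surjective _))
      (lt_natCast_of_add_one_le (supportDim_quotient_range_lsmul_add_one_le hx) hd')
      fun i hi => hP.H_quotient_range_lsmul hx i (hH' i hi) (hH' _ (Nat.lt_succ_of_lt hi))

/-- **Grothendieck vanishing** for ZD-modules: `Hⁱ(M) = 0` for `i > dim M`. By induction, some
`x` in the annihilator of a given `y ∈ Hⁱ(M)` acts injectively on `Hⁱ(M)`, so that `y = 0`. -/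
theorem subsingleton_H_of_supportDim_lt (d : ℕ) :
    ∀ (M : Type u) [AddCommGroup M] [Module R M], IsZDModule R M →
      Module.supportDim R M < (d : WithBot ℕ∞) → ∀ i, d ≤ i → Subsingleton (H I J i M) := by
  induction d with
  | zero =>
    intro M _ _ _ hd i _
    have : Subsingleton M := subsingleton_of_supportDim_lt_zero hd
    exact subsingleton_H_of_subsingleton i
  | succ d ih =>
    intro M _ _ hZD hd i hi
    obtain ⟨i, rfl⟩ : ∃ k, i = k + 1 := ⟨i - 1, by omega⟩
    obtain ⟨e⟩ := nonempty_H_succ_equiv_quotient_gamma (I := I) (J := J) (A := M) i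
    refine (Equiv.subsingleton_congr e.toEquiv).2 (subsingleton_of_forall_eq 0 fun y => ?_)
    have hZD' : IsZDModule R (M ⧸ gamma I J M) :=
      hZD.of_surjective _ (Submodule.mkQ_surjective _)
    have hd' := (Module.supportDim_le_of_surjective _ (gamma I J M).mkQ_surjective).trans_lt hd
    -- `y` is torsion, so its annihilator lies in `W̃(I,J)`
    obtain ⟨x, hxy, hx⟩ := exists_isSMulRegular hZD' (I := I) (J := J) gamma_quotient_gamma
      (annihilator_mem_WTilde (Submodule.fg_span_singleton y) (by rw [gamma_H]; exact le_top))
    rw [Submodule.mem_annihilator_span_singleton] at hxy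
    obtain ⟨δ, -, -, h₁⟩ := exists_H_exact (I := I) (J := J)
      (f := LinearMap.lsmul R (M ⧸ gamma I J M) x) hx (Submodule.mkQ_surjective _)
      (Submodule.ker_mkQ _).symm i
    have := ih _ (hZD'.of_surjective _ (Submodule.mkQ_surjective _))
      (lt_natCast_of_add_one_le (supportDim_quotient_range_lsmul_add_one_le hx) hd') i
      (by omega)
    obtain ⟨z, rfl⟩ : y ∈ LinearMap.range δ := h₁.ge (by rwa [LinearMap.mem_ker, Hmap_lsmul])
    rw [Subsingleton.elim z 0, map_zero]

theorem IsSerreProperty.iff_exists_smul_top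
    {P : ∀ (N : Type u) [AddCommGroup N] [Module R N], Prop} (hP : IsSerreProperty P)
    {N : Type u} [AddCommGroup N] [Module R N]
    (h : ∀ 𝔞 ∈ WTilde I J, P (N ⧸ 𝔞 • (⊤ : Submodule R N))) :
    P N ↔ ∃ 𝔞 ∈ WTilde I J, ∃ m : ℕ, P ↥(𝔞 ^ m • (⊤ : Submodule R N)) := by
  refine ⟨fun hN => ⟨⊤, top_mem_WTilde, 0,
    hP.of_injective (Submodule.subtype _) Subtype.val_injective hN⟩, ?_⟩
  rintro ⟨𝔞, h𝔞, m, hm⟩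
  exact hP.of_exact (Submodule.subtype _) (Submodule.mkQ _) (by simp) hm
    (h _ (pow_mem_WTilde h𝔞 m))

theorem IsSerreProperty.iff_exists_quotient_torsionBySet
    {P : ∀ (N : Type u) [AddCommGroup N] [Module R N], Prop} (hP : IsSerreProperty P)
    {N : Type u} [AddCommGroup N] [Module R N]
    (h : ∀ 𝔞 ∈ WTilde I J, P (N ⧸ 𝔞 • (⊤ : Submodule R N))) :
    P N ↔ ∃ 𝔞 ∈ WTilde I J, ∃ m : ℕ,
      P (N ⧸ Submodule.torsionBySet R N (↑(𝔞 ^ m) : Set R)) := by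
  refine ⟨fun hN => ⟨⊤, top_mem_WTilde, 0, hP.of_surjective _ (Submodule.mkQ_surjective _) hN⟩, ?_⟩
  rintro ⟨𝔞, h𝔞, m, hm⟩
  exact (hP.iff_exists_smul_top h).2
    ⟨𝔞, h𝔞, m, hP.smul_top_of_quotient_torsionBySet (IsNoetherian.noetherian _) hm⟩

end ZDModules

end PairLocalCohomology

open PairLocalCohomology in
theorem corollary4p6 {R : Type u} [CommRing R] [IsNoetherianRing R] (I J : Ideal R)
    (M : Type u) [AddCommGroup M] [Module R M] (hZD : IsZDModule R M)
    (hdim : Module.supportDim R M < ⊤) (n : ℕ) (hn : 1 ≤ n) :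
    -- (i) the finitely generated case
    ((∀ i, n < i → Module.Finite R (H I J i M)) →
      (Module.Finite R (H I J n M) ↔
        ∃ 𝔞 ∈ WTilde I J, ∃ m : ℕ,
          Module.Finite R ↥(𝔞 ^ m • (⊤ : Submodule R (H I J n M)))) ∧
      (Module.Finite R (H I J n M) ↔
        ∃ 𝔞 ∈ WTilde I J, ∃ m : ℕ,
          Module.Finite R
            (H I J n M ⧸ Submodule.torsionBySet R (H I J n M) (↑(𝔞 ^ m) : Set R)))) ∧
    -- (ii) the artinian case
    ((∀ i, n < i → IsArtinian R (H I J i M)) →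
      (IsArtinian R (H I J n M) ↔
        ∃ 𝔞 ∈ WTilde I J, ∃ m : ℕ,
          IsArtinian R ↥(𝔞 ^ m • (⊤ : Submodule R (H I J n M))))) ∧
    -- (iii) the zero case
    ((∀ i, n < i → Subsingleton (H I J i M)) →
      (∀ 𝔞 ∈ WTilde I J, ∀ j : ℕ,
        𝔞 ^ j • (⊤ : Submodule R (H I J n M)) = ⊤) ∧
      (Subsingleton (H I J n M) ↔
        ∃ 𝔞 ∈ WTilde I J, ∃ m : ℕ, 𝔞 ^ m • (⊤ : Submodule R (H I J n M)) = ⊥)) ∧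
    -- in particular, everything holds for `n = dim M` and for `n = cd(I,J,M)`
    ((Module.supportDim R M = (n : WithBot ℕ∞) ∨ cd I J M = (n : WithBot ℕ∞)) →
      (∀ i, n < i → Subsingleton (H I J i M)) ∧
      (Module.Finite R (H I J n M) ↔
        ∃ 𝔞 ∈ WTilde I J, ∃ m : ℕ,
          Module.Finite R ↥(𝔞 ^ m • (⊤ : Submodule R (H I J n M)))) ∧
      (Module.Finite R (H I J n M) ↔
        ∃ 𝔞 ∈ WTilde I J, ∃ m : ℕ,
          Module.Finite R
            (H I J n M ⧸ Submodule.torsionBySet R (H I J n M) (↑(𝔞 ^ m) : Set R))) ∧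
      (IsArtinian R (H I J n M) ↔
        ∃ 𝔞 ∈ WTilde I J, ∃ m : ℕ,
          IsArtinian R ↥(𝔞 ^ m • (⊤ : Submodule R (H I J n M)))) ∧
      (∀ 𝔞 ∈ WTilde I J, ∀ j : ℕ,
        𝔞 ^ j • (⊤ : Submodule R (H I J n M)) = ⊤) ∧
      (Subsingleton (H I J n M) ↔
        ∃ 𝔞 ∈ WTilde I J, ∃ m : ℕ,
          𝔞 ^ m • (⊤ : Submodule R (H I J n M)) = ⊥)) := by
  obtain ⟨n, rfl⟩ : ∃ k, n = k + 1 := ⟨n - 1, by omega⟩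
  obtain ⟨d, hd⟩ : ∃ d : ℕ, Module.supportDim R M < (d : WithBot ℕ∞) := by
    cases hdM : Module.supportDim R M with
    | bot => exact ⟨0, WithBot.bot_lt_coe _⟩
    | coe a =>
      rw [hdM, ← WithBot.coe_top, WithBot.coe_lt_coe] at hdim
      lift a to ℕ using hdim.ne
      exact ⟨a + 1, by exact_mod_cast Nat.lt_succ_self a⟩
  have hfin (h : ∀ i, n + 1 < i → Module.Finite R (H I J i M)) 𝔞 (h𝔞 : 𝔞 ∈ WTilde I J) :=
    isSerreProperty_finite.H_quotient_smul_top h𝔞 n d M hZD hd h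
  have hart (h : ∀ i, n + 1 < i → IsArtinian R (H I J i M)) 𝔞 (h𝔞 : 𝔞 ∈ WTilde I J) :=
    isSerreProperty_isArtinian.H_quotient_smul_top h𝔞 n d M hZD hd h
  have hsub (h : ∀ i, n + 1 < i → Subsingleton (H I J i M)) 𝔞 (h𝔞 : 𝔞 ∈ WTilde I J) :=
    isSerreProperty_subsingleton.H_quotient_smul_top h𝔞 n d M hZD hd h
  have h₁ (h : ∀ i, n + 1 < i → Module.Finite R (H I J i M)) :=
    And.intro (isSerreProperty_finite.iff_exists_smul_top (hfin h))
      (isSerreProperty_finite.iff_exists_quotient_torsionBySet (hfin h))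
  have h₂ (h : ∀ i, n + 1 < i → IsArtinian R (H I J i M)) :=
    isSerreProperty_isArtinian.iff_exists_smul_top (hart h)
  have h₃ (h : ∀ i, n + 1 < i → Subsingleton (H I J i M)) :
      (∀ 𝔞 ∈ WTilde I J, ∀ j : ℕ, 𝔞 ^ j • (⊤ : Submodule R (H I J (n + 1) M)) = ⊤) ∧
      (Subsingleton (H I J (n + 1) M) ↔
        ∃ 𝔞 ∈ WTilde I J, ∃ m : ℕ, 𝔞 ^ m • (⊤ : Submodule R (H I J (n + 1) M)) = ⊥) := by
    constructor
    · exact fun 𝔞 h𝔞 j =>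
        Submodule.Quotient.subsingleton_iff.1 (hsub h _ (pow_mem_WTilde h𝔞 j))
    · simp_rw [← Submodule.subsingleton_iff_eq_bot]
      exact isSerreProperty_subsingleton.iff_exists_smul_top (hsub h)
  refine ⟨h₁, h₂, h₃, fun hn' => ?_⟩
  have hvan (i : ℕ) (hi : n + 1 < i) : Subsingleton (H I J i M) := by
    rcases hn' with hn' | hn'
    · exact subsingleton_H_of_supportDim_lt i M hZD (by rw [hn']; exact_mod_cast hi) i le_rfl
    · by_contra hnt
      rw [not_subsingleton_iff_nontrivial] at hnt
      have hle : (i : WithBot ℕ∞) ≤ cd I J M :=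
        le_iSup₂ (f := fun (i : ℕ) (_ : Nontrivial (H I J i M)) => (i : WithBot ℕ∞)) i hnt
      rw [hn'] at hle
      exact absurd hi (not_lt_of_ge (by exact_mod_cast hle))
  have hvfin := h₁ fun i hi => have := hvan i hi; inferInstance
  exact ⟨hvan, hvfin.1, hvfin.2, h₂ fun i hi => have := hvan i hi; inferInstance, h₃ hvan⟩
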